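/- Let $A\in\mathbb{R}^{n\times n}$ be symmetric with largest and smallest eigenvalues $\alpha_1$ and $\alpha_n$, let $0\neq g\in\mathbb{R}^n$ and $\Delta>0$, and let $\|\cdot\|$ be the Euclidean norm. Let $s_{opt}$ be a minimizer of $q(s)=g^Ts+\frac12 s^TAs$ over $\|s\|\le\Delta$, with Lagrange multiplier $\lambda_{opt}$, i.e. $\lambda_{opt}\ge 0$, $(A+\lambda_{opt}I)s_{opt}=-g$, $\lambda_{opt}(\Delta-\|s_{opt}\|)=0$. Assume the easy case: it is not the case that both $\lambda_{opt}=-\alpha_n$ and $g\perp\mathcal{N}(A-\alpha_nI)$. Let $\beta_0=\|g\|$, and let $q_0=g/\beta_0,q_1,q_2,\dots$ be produced by the symmetric Lanczos process $\beta_{j+1}q_{j+1}=Aq_j-(q_j^TAq_j)q_j-\beta_jq_{j-1}$ ($q_{-1}=0$, and $\beta_{j+1}$ is the norm of the right-hand side). Let $k_{\max}$ be the first $k$ with $\beta_{k+1}=0$. For $0\le k\le k_{\max}$ put $Q_k=(q_0,\dots,q_k)$ and $T_k=Q_k^TAQ_k$. Let $s_k=Q_kh_k$ be the $k$-th iterate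 of the GLTR (generalized Lanczos trust-region) method, i.e. a minimizer of $q$ over all $s\in\mathrm{span}\{g,Ag,\dots,A^kg\}$ with $\|s\|\le\Delta$, and let $\lambda_k$ be its multiplier, i.e. $\lambda_k\ge0$, $(T_k+\lambda_kI)h_k=-\beta_0e_1$, $\lambda_k(\Delta-\|h_k\|)=0$. Put $$\kappa=\frac{\alpha_1+\lambda_{opt}}{\alpha_n+\lambda_{opt}},\quad t=\frac{\sqrt\kappa-1}{\sqrt\kappa+1},\quad \eta_{k1}=\frac{\beta_0^2}{\Delta^2+\beta_0^2e_1^T(T_k+\lambda_{opt}I)^{-2}e_1},\quad \eta_{k2}=\frac{2}{\Delta^2+\beta_0^2e_1^T(T_k+\lambda_{opt}I)^{-2}e_1}.$$ If $\|s_{opt}\|=\Delta$, then for every $k\in\{0,1,\dots,k_{\max}\}$ with $\|s_k\|=\Delta$, $$\|(A+\lambda_kI)s_k+g\|\le\Big(\frac{4\eta_{k1}\Delta^2}{\beta_0}+8(\alpha_1+\lambda_{opt})\eta_{k2}\Delta^3\Big)t^{2(k+1)}+4\sqrt\kappa\,\Delta(\alpha_1+\lambda_{opt})\,t^{k+1}.$$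 -/

import Mathlib

noncomputable section

namespace GLTR

/-- The quadratic model `q(s) = gᵀ s + (1/2) sᵀ A s`. -/
def objective {ι : Type*} [Fintype ι] [DecidableEq ι] (A : Matrix ι ι ℝ)
    (g s : EuclideanSpace ℝ ι) : ℝ :=
  inner ℝ g s + (1 / 2) * inner ℝ s (Matrix.toEuclideanLin A s)

/-- `s` solves the trust-region subproblem `min q(x)` over `x ∈ S`, `‖x‖ ≤ Δ`. -/
structure IsTRSSolutionOn {ι : Type*} [Fintype ι] [DecidableEq ι] (A : Matrix ι ι ℝ)
    (g : EuclideanSpace ℝ ι) (Δ : ℝ) (S : Submodule ℝ (EuclideanSpace ℝ ι))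
    (s : EuclideanSpace ℝ ι) : Prop where
  mem : s ∈ S
  norm_le : ‖s‖ ≤ Δ
  le : ∀ x ∈ S, ‖x‖ ≤ Δ → objective A g s ≤ objective A g x

/-- `lam` is a Lagrange multiplier for the constraint `‖s‖ ≤ Δ` at the point `s`: it is
nonnegative, `(A + lam I) s = -g`, and complementary slackness holds.  At a solution `s` of the
trust-region subproblem over the whole space, `A + lam I ⪰ 0` is then automatic. -/
structure IsMultiplier {ι : Type*} [Fintype ι] [DecidableEq ι] (A : Matrix ι ι ℝ)
    (g : EuclideanSpace ℝ ι) (Δ : ℝ) (s : EuclideanSpace ℝ ι) (lam : ℝ) : Prop where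
  nonneg : 0 ≤ lam
  stationary : Matrix.toEuclideanLin A s + lam • s = -g
  slackness : lam * (Δ - ‖s‖) = 0

/-- The hard case: `g` is orthogonal to the eigenspace of `A` for its smallest eigenvalue `αmin`,
and the optimal multiplier is `-αmin`. -/
def IsHardCase {n : ℕ} (A : Matrix (Fin n) (Fin n) ℝ) (g : EuclideanSpace ℝ (Fin n))
    (αmin lam : ℝ) : Prop :=
  (∀ v : EuclideanSpace ℝ (Fin n), Matrix.toEuclideanLin A v = αmin • v → inner ℝ g v = 0) ∧
    lam = -αmin

/-- The `(k+1)`-st Krylov space `span {g, A g, …, A^k g}`. -/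
def krylov {n : ℕ} (A : Matrix (Fin n) (Fin n) ℝ) (g : EuclideanSpace ℝ (Fin n)) (k : ℕ) :
    Submodule ℝ (EuclideanSpace ℝ (Fin n)) :=
  Submodule.span ℝ (Set.range fun j : Fin (k + 1) => Matrix.toEuclideanLin (A ^ (j : ℕ)) g)

/-- The symmetric Lanczos process started at `g`.  Step `j` returns `(q_{j-1}, q_j, β_j)`, where
`β_0 = ‖g‖`, `q_0 = g / β_0` (and `q_{-1} = 0`), and
`β_{j+1} q_{j+1} = A q_j - δ_j q_j - β_j q_{j-1}` with `δ_j = q_jᵀ A q_j`,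
`β_{j+1}` being the norm of the right-hand side. -/
def lanczos {n : ℕ} (A : Matrix (Fin n) (Fin n) ℝ) (g : EuclideanSpace ℝ (Fin n)) :
    ℕ → EuclideanSpace ℝ (Fin n) × EuclideanSpace ℝ (Fin n) × ℝ
  | 0 => (0, ‖g‖⁻¹ • g, ‖g‖)
  | j + 1 =>
    let qprev := (lanczos A g j).1
    let q := (lanczos A g j).2.1
    let β := (lanczos A g j).2.2
    let w := Matrix.toEuclideanLin A q - inner ℝ q (Matrix.toEuclideanLin A q) • q - β • qprev
    (q, ‖w‖⁻¹ • w, ‖w‖)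

/-- The Lanczos vector `q_j`. -/
def lanczosVec {n : ℕ} (A : Matrix (Fin n) (Fin n) ℝ) (g : EuclideanSpace ℝ (Fin n)) (j : ℕ) :
    EuclideanSpace ℝ (Fin n) := (lanczos A g j).2.1

/-- The Lanczos coefficient `β_j`. -/
def lanczosBeta {n : ℕ} (A : Matrix (Fin n) (Fin n) ℝ) (g : EuclideanSpace ℝ (Fin n)) (j : ℕ) :
    ℝ := (lanczos A g j).2.2

/-- The first iteration `k_max` at which the Lanczos process breaks down, i.e. the first `k`
with `β_{k+1} = 0`. -/
def breakdown {n : ℕ} (A : Matrix (Fin n) (Fin n) ℝ) (g : EuclideanSpace ℝ (Fin n)) : ℕ :=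
  sInf {k : ℕ | lanczosBeta A g (k + 1) = 0}

/-- The projected matrix `T_k = Q_kᵀ A Q_k`, where `Q_k = (q_0, …, q_k)`. -/
def projMatrix {n : ℕ} (A : Matrix (Fin n) (Fin n) ℝ) (g : EuclideanSpace ℝ (Fin n)) (k : ℕ) :
    Matrix (Fin (k + 1)) (Fin (k + 1)) ℝ :=
  Matrix.of fun i j =>
    inner ℝ (lanczosVec A g i) (Matrix.toEuclideanLin A (lanczosVec A g j))

/-- The vector `Q_k h`. -/
def lift {n : ℕ} (A : Matrix (Fin n) (Fin n) ℝ) (g : EuclideanSpace ℝ (Fin n)) (k : ℕ)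
    (h : EuclideanSpace ℝ (Fin (k + 1))) : EuclideanSpace ℝ (Fin n) :=
  ∑ j : Fin (k + 1), h j • lanczosVec A g j

/-- `(s, lam)` is a pair `(s_k, λ_k)` produced by iteration `k` of the GLTR method: `s = Q_k h`
solves the trust-region subproblem restricted to the Krylov space, and `lam` is the Lagrange
multiplier at `h` of the reduced problem with matrix `T_k` and vector `β_0 e_1`. -/
def IsGLTRIterate {n : ℕ} (A : Matrix (Fin n) (Fin n) ℝ) (g : EuclideanSpace ℝ (Fin n)) (Δ : ℝ)
    (k : ℕ) (s : EuclideanSpace ℝ (Fin n)) (lam : ℝ) : Prop :=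
  IsTRSSolutionOn A g Δ (krylov A g k) s ∧
    ∃ h : EuclideanSpace ℝ (Fin (k + 1)), s = lift A g k h ∧
      IsMultiplier (projMatrix A g k) (EuclideanSpace.single 0 ‖g‖) Δ h lam

/-- `e_1ᵀ (T_k + lam I)^{-2} e_1`. -/
def invSqEntry {n : ℕ} (A : Matrix (Fin n) (Fin n) ℝ) (g : EuclideanSpace ℝ (Fin n)) (k : ℕ)
    (lam : ℝ) : ℝ :=
  (((projMatrix A g k + lam • (1 : Matrix (Fin (k + 1)) (Fin (k + 1)) ℝ))⁻¹) ^ 2) 0 0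

/-- `η_{k1} = β_0² / (Δ² + β_0² e_1ᵀ (T_k + λ_opt I)^{-2} e_1)`. -/
def eta₁ {n : ℕ} (A : Matrix (Fin n) (Fin n) ℝ) (g : EuclideanSpace ℝ (Fin n)) (Δ : ℝ) (k : ℕ)
    (lamOpt : ℝ) : ℝ :=
  ‖g‖ ^ 2 / (Δ ^ 2 + ‖g‖ ^ 2 * invSqEntry A g k lamOpt)

/-- `η_{k2} = 2 / (Δ² + β_0² e_1ᵀ (T_k + λ_opt I)^{-2} e_1)`. -/
def eta₂ {n : ℕ} (A : Matrix (Fin n) (Fin n) ℝ) (g : EuclideanSpace ℝ (Fin n)) (Δ : ℝ) (k : ℕ)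
    (lamOpt : ℝ) : ℝ :=
  2 / (Δ ^ 2 + ‖g‖ ^ 2 * invSqEntry A g k lamOpt)

end GLTR

end

/-!
Put `B = A + λ_opt I` and `b = α₁ + λ_opt`. The residual `r = (A + λ_k I) s_k + g` is orthogonal to
`s_k` (`GLTR.inner_lift_residual`, from the orthonormality of the Lanczos vectors), and
`B s_opt = -g`. Hence `B (s_k - s_opt) = r + (λ_opt - λ_k) s_k` is an orthogonal decomposition, and
`‖r‖ ≤ ‖B (s_k - s_opt)‖`: no estimate of `λ_k - λ_opt` is needed.

In the easy case `B` is positive definite (`GLTR.IsTRSSolutionOn.add_multiplier_pos`), with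
eigenvalues in `[αₙ + λ_opt, b]`. On the sphere `‖s‖ = Δ` the objective is, up to a constant, half
the squared energy norm `⟨s - s_opt, B (s - s_opt)⟩` (`GLTR.objective_sub_objective`), so `s_k`
minimizes the energy norm of the error among the vectors of the Krylov space of norm `Δ`. A competitor comes
from Chebyshev polynomials: some `v = q(B) g` in the Krylov space has `‖v - s_opt‖ ≤ 2 t^(k+1) Δ`
(`exists_poly_norm_aeval_map_sub_le`), and rescaling it to norm `Δ` at most doubles the error
(`exists_norm_eq_norm_sub_le`). Thus the squared energy norm of `s_k - s_opt` is at most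
`b (4 t^(k+1) Δ)²`, and
`‖r‖ ≤ ‖B (s_k - s_opt)‖ ≤ 4 b Δ t^(k+1)`. This is at most the last term of the claimed bound, as
`√κ ≥ 1`, while the other terms are nonnegative.
-/

/-! ### Chebyshev polynomials -/

section Approximation

open Polynomial

/-- Chebyshev's min-max estimate behind the convergence theory of conjugate gradients. For `a < b`
the polynomial is the Chebyshev polynomial `T_m`, transplanted from `[-1, 1]` to `[a, b]` and
divided by its value at `0`; that value is at least `t⁻¹ ^ m / 2`. -/
theorem exists_poly_abs_le_two_mul_pow {a b : ℝ} (ha : 0 < a) (hab : a ≤ b) {m : ℕ} (hm : m ≠ 0)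
    {t : ℝ} (ht : t = (√(b / a) - 1) / (√(b / a) + 1)) :
    ∃ p : ℝ[X], p.natDegree ≤ m ∧ p.eval 0 = 1 ∧
      ∀ x ∈ Set.Icc a b, |p.eval x| ≤ 2 * t ^ m := by
  rcases hab.eq_or_lt with rfl | hlt
  -- For `a = b` the interval is a point and `t = 0`: a linear polynomial vanishing there suffices.
  · refine ⟨1 - C a⁻¹ * X, ?_, by simp, fun x hx => ?_⟩
    · refine (natDegree_sub_le _ _).trans ?_
      have h : (C a⁻¹ * X : ℝ[X]).natDegree ≤ 1 := by compute_degree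
      simp only [natDegree_one]
      omega
    · obtain rfl : x = a := le_antisymm hx.2 hx.1
      simp [ht, ha.ne', hm]
  · set r := √(b / a) with hr
    have hr2 : r ^ 2 = b / a := Real.sq_sqrt (div_pos (ha.trans hlt) ha).le
    have hr1 : 1 < r := by
      rw [hr, Real.lt_sqrt (by norm_num), one_pow, one_lt_div ha]; exact hlt
    have ht0 : 0 < t := by rw [ht]; exact div_pos (by linarith) (by linarith)
    set y := (b + a) / (b - a) with hy
    have hba : 0 < b - a := by linarith
    -- `y`, the image of `0`, equals `(t + t⁻¹) / 2`, whence `T_m y = (t ^ m + t⁻¹ ^ m) / 2`.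
    have hcosh : Real.cosh (-Real.log t) = y := by
      rw [Real.cosh_neg, Real.cosh_log ht0, ht, hy]
      have h1 : b = r ^ 2 * a := by rw [hr2]; field_simp
      have h2 : r - 1 ≠ 0 := by linarith
      have h3 : r + 1 ≠ 0 := by linarith
      have h4 : r ^ 2 * a + a = (r ^ 2 + 1) * a := by ring
      have h5 : r ^ 2 * a - a = (r - 1) * (r + 1) * a := by ring
      rw [h1, h4, h5]
      field_simp
      ring
    set M := (Chebyshev.T ℝ m).eval y with hM
    have hMt : t⁻¹ ^ m / 2 ≤ M := by
      have e : ((m : ℤ) : ℝ) * -Real.log t = Real.log (t⁻¹ ^ m) := by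
        rw [Real.log_pow, Real.log_inv]; simp
      rw [hM, ← hcosh, Chebyshev.T_real_cosh, e, Real.cosh_log (by positivity)]
      have : 0 < (t⁻¹ ^ m)⁻¹ := by positivity
      linarith
    have hM0 : 0 < M := lt_of_lt_of_le (by positivity) hMt
    refine ⟨C M⁻¹ * (Chebyshev.T ℝ m).comp (C y - C (2 / (b - a)) * X), ?_, ?_, ?_⟩
    · refine (natDegree_C_mul_le _ _).trans (natDegree_comp_le.trans ?_)
      have h1 : (C y - C (2 / (b - a)) * X : ℝ[X]).natDegree ≤ 1 := by
        compute_degree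
      calc _ ≤ m * 1 := Nat.mul_le_mul (by simp [Chebyshev.natDegree_T]) h1
        _ = m := mul_one m
    · simp [← hM, hM0.ne']
    · intro x hx
      have hz : |y - 2 / (b - a) * x| ≤ 1 := by
        have : y - 2 / (b - a) * x = (b + a - 2 * x) / (b - a) := by rw [hy]; ring
        rw [this, abs_div, abs_of_pos hba, div_le_one hba, abs_le]
        constructor <;> linarith [hx.1, hx.2]
      have h1 := Chebyshev.abs_eval_T_real_le_one m hz
      have h2 : M⁻¹ ≤ 2 * t ^ m := by
        rw [inv_le_comm₀ hM0 (by positivity)]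
        refine le_trans (le_of_eq ?_) hMt
        rw [mul_inv, inv_pow]; ring
      simp only [eval_mul, eval_C, eval_comp, eval_sub, eval_X, abs_mul, abs_of_pos (inv_pos.2 hM0)]
      calc _ ≤ M⁻¹ * 1 := by gcongr
        _ ≤ _ := by linarith

/-! ### Estimates in an orthonormal eigenbasis -/

section Eigenbasis

variable {ι E : Type*} [Fintype ι] [NormedAddCommGroup E] [InnerProductSpace ℝ E]
  {T : E →ₗ[ℝ] E} {b : OrthonormalBasis ι ℝ E} {μ : ι → ℝ}

theorem inner_eigenbasis_aeval (hT : T.IsSymmetric) (hb : ∀ i, T (b i) = μ i • b i)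
    (p : ℝ[X]) (i : ι) (x : E) : inner ℝ (b i) (aeval T p x) = p.eval (μ i) * inner ℝ (b i) x := by
  induction p using Polynomial.induction_on' generalizing x with
  | add p q hp hq => simp [inner_add_right, hp, hq, add_mul]
  | monomial n c =>
    induction n generalizing x with
    | zero => simp [inner_smul_right, Module.algebraMap_end_apply]
    | succ n ih =>
      have h := ih (T x)
      rw [← hT, hb, real_inner_smul_left] at h
      simp only [aeval_monomial, eval_monomial, Module.End.mul_apply,
        Module.algebraMap_end_apply, pow_succ] at h ⊢
      rw [h]; ring

theorem norm_aeval_le_of_eigenbasis (hT : T.IsSymmetric) (hb : ∀ i, T (b i) = μ i • b i)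
    {p : ℝ[X]} {M : ℝ} (hM : 0 ≤ M) (hp : ∀ i, |p.eval (μ i)| ≤ M) (x : E) :
    ‖aeval T p x‖ ≤ M * ‖x‖ := by
  refine (abs_le_of_sq_le_sq' ?_ (by positivity)).2
  rw [mul_pow, ← b.sum_sq_norm_inner_right, ← b.sum_sq_norm_inner_right, Finset.mul_sum]
  refine Finset.sum_le_sum fun i _ => ?_
  rw [inner_eigenbasis_aeval hT hb, norm_mul, mul_pow]
  gcongr
  exact hp i

theorem inner_map_self_le_of_eigenbasis (hT : T.IsSymmetric) (hb : ∀ i, T (b i) = μ i • b i)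
    {c : ℝ} (hc : ∀ i, μ i ≤ c) (x : E) : inner ℝ x (T x) ≤ c * ‖x‖ ^ 2 := by
  rw [← b.sum_inner_mul_inner, ← b.sum_sq_norm_inner_right, Finset.mul_sum]
  refine Finset.sum_le_sum fun i _ => ?_
  rw [← hT, hb, real_inner_smul_left, real_inner_comm, Real.norm_eq_abs, sq_abs]
  nlinarith [mul_le_mul_of_nonneg_right (hc i) (sq_nonneg (inner ℝ (b i) x))]

theorem norm_map_sq_le_of_eigenbasis (hT : T.IsSymmetric) (hb : ∀ i, T (b i) = μ i • b i)
    {c : ℝ} (h0 : ∀ i, 0 ≤ μ i) (hc : ∀ i, μ i ≤ c) (x : E) :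
    ‖T x‖ ^ 2 ≤ c * inner ℝ x (T x) := by
  rw [← b.sum_inner_mul_inner, ← b.sum_sq_norm_inner_right, Finset.mul_sum]
  refine Finset.sum_le_sum fun i _ => ?_
  rw [← hT, hb, real_inner_smul_left, real_inner_comm, Real.norm_eq_abs, sq_abs]
  nlinarith [mul_le_mul_of_nonneg_right (hc i)
    (mul_nonneg (h0 i) (sq_nonneg (inner ℝ x (b i))))]

end Eigenbasis

/-- The Krylov approximation bound: if the spectrum of `B` lies in `[a, b]`, then `x` is
approximated up to `2 t ^ (k + 1) ‖x‖` by a polynomial of degree at most `k` in `B` applied to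
`B x`. The polynomial is `(1 - p) / X` for the `p` of `exists_poly_abs_le_two_mul_pow`. -/
theorem exists_poly_norm_aeval_map_sub_le {ι E : Type*} [Fintype ι] [NormedAddCommGroup E]
    [InnerProductSpace ℝ E] {B : E →ₗ[ℝ] E} {e : OrthonormalBasis ι ℝ E} {μ : ι → ℝ}
    (hB : B.IsSymmetric) (he : ∀ i, B (e i) = μ i • e i) {a b : ℝ} (ha : 0 < a) (hab : a ≤ b)
    (hμ : ∀ i, μ i ∈ Set.Icc a b) {t : ℝ} (ht : t = (√(b / a) - 1) / (√(b / a) + 1))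
    (ht0 : 0 ≤ t) (x : E) (k : ℕ) :
    ∃ q : ℝ[X], q.natDegree ≤ k ∧ ‖aeval B q (B x) - x‖ ≤ 2 * t ^ (k + 1) * ‖x‖ := by
  obtain ⟨p, hpd, hp0, hp⟩ := exists_poly_abs_le_two_mul_pow ha hab k.succ_ne_zero ht
  refine ⟨(1 - p).divX, ?_, ?_⟩
  · rw [natDegree_divX_eq_natDegree_tsub_one]
    have := natDegree_sub_le 1 p
    simp only [natDegree_one] at this
    omega
  · have h : p = 1 - (1 - p).divX * X := by
      have := divX_mul_X_add (1 - p)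
      rw [coeff_sub, coeff_zero_eq_eval_zero p, hp0] at this
      simp only [coeff_one_zero, sub_self, map_zero, add_zero] at this
      rw [this]; ring
    have h2 : aeval B p x = x - aeval B (1 - p).divX (B x) := by
      conv_lhs => rw [h]
      simp
    rw [← norm_neg, neg_sub, ← h2]
    exact norm_aeval_le_of_eigenbasis hB he (by positivity) (fun i => hp _ (hμ i)) x

end Approximation

/-! ### The Lanczos process -/

namespace GLTR

variable {n : ℕ} {A : Matrix (Fin n) (Fin n) ℝ} {g : EuclideanSpace ℝ (Fin n)}

/-- Also for `w = 0`, so the Lanczos recurrence below holds at the breakdown step as well. -/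
theorem smul_inv_norm_smul {E : Type*} [NormedAddCommGroup E] [NormedSpace ℝ E] (w : E) :
    ‖w‖ • ‖w‖⁻¹ • w = w := by
  by_cases hw : w = 0
  · simp [hw]
  · rw [smul_smul, mul_inv_cancel₀ (norm_ne_zero_iff.2 hw), one_smul]

theorem lanczosVec_zero : lanczosVec A g 0 = ‖g‖⁻¹ • g := rfl

theorem beta_smul_lanczosVec_one :
    lanczosBeta A g 1 • lanczosVec A g 1 = Matrix.toEuclideanLin A (lanczosVec A g 0) -
      (inner ℝ (lanczosVec A g 0) (Matrix.toEuclideanLin A (lanczosVec A g 0)) : ℝ) •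
        lanczosVec A g 0 := by
  refine (smul_inv_norm_smul _).trans ?_
  simp [lanczosVec, lanczos]

theorem beta_smul_lanczosVec_add_two (j : ℕ) :
    lanczosBeta A g (j + 2) • lanczosVec A g (j + 2) =
      Matrix.toEuclideanLin A (lanczosVec A g (j + 1)) -
      (inner ℝ (lanczosVec A g (j + 1)) (Matrix.toEuclideanLin A (lanczosVec A g (j + 1))) : ℝ) •
        lanczosVec A g (j + 1) - lanczosBeta A g (j + 1) • lanczosVec A g j :=
  smul_inv_norm_smul _

theorem norm_lanczosVec_succ {j : ℕ} (h : lanczosBeta A g (j + 1) ≠ 0) :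
    ‖lanczosVec A g (j + 1)‖ = 1 := by
  change ‖(‖_‖⁻¹ • _ : EuclideanSpace ℝ (Fin n))‖ = 1
  rw [norm_smul, norm_inv, norm_norm]
  exact inv_mul_cancel₀ h

/-- The Lanczos vectors are orthonormal up to the breakdown. The new vector is orthogonal to
`q_i` because `A q_i` lies in the span of `q_{i-1}, q_i, q_{i+1}` and `A` is symmetric. -/
theorem inner_lanczosVec (hA : (Matrix.toEuclideanLin A).IsSymmetric) (hg : g ≠ 0) (k : ℕ)
    (hβ : ∀ j < k, lanczosBeta A g (j + 1) ≠ 0) :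
    ∀ i ≤ k, ∀ j ≤ k, (inner ℝ (lanczosVec A g i) (lanczosVec A g j) : ℝ) =
      if i = j then 1 else 0 := by
  induction k with
  | zero =>
    intro i hi j hj
    obtain rfl : i = 0 := by omega
    obtain rfl : j = 0 := by omega
    rw [real_inner_self_eq_norm_sq, lanczosVec_zero, norm_smul, norm_inv, norm_norm,
      inv_mul_cancel₀ (norm_ne_zero_iff.2 hg)]
    simp
  | succ k ih =>
    specialize ih fun j hj => hβ j (by omega)
    have hk := hβ k (by omega)
    have key : ∀ i ≤ k, (inner ℝ (lanczosVec A g i) (lanczosVec A g (k + 1)) : ℝ) = 0 := by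
      intro i hi
      suffices h : (inner ℝ (lanczosVec A g i)
          (lanczosBeta A g (k + 1) • lanczosVec A g (k + 1)) : ℝ) = 0 by
        rw [real_inner_smul_right] at h
        exact (mul_eq_zero.1 h).resolve_left hk
      rcases k with _ | k
      · obtain rfl : i = 0 := by omega
        rw [zero_add, beta_smul_lanczosVec_one, inner_sub_right, real_inner_smul_right,
          ih 0 le_rfl 0 le_rfl]
        simp
      · rw [beta_smul_lanczosVec_add_two, inner_sub_right, inner_sub_right, real_inner_smul_right,
          real_inner_smul_right, ih i hi (k + 1) le_rfl, ih i hi k (by omega)]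
        rcases Nat.lt_or_ge k i with h | h
        · obtain rfl : i = k + 1 := by omega
          simp
        · rw [← hA, if_neg (by omega : i ≠ k + 1)]
          rcases i with _ | i
          · have e := beta_smul_lanczosVec_one (A := A) (g := g)
            rw [eq_sub_iff_add_eq] at e
            rw [← e, inner_add_left, real_inner_smul_left, real_inner_smul_left,
              ih 1 (by omega) _ le_rfl, ih 0 (by omega) _ le_rfl]
            by_cases hk0 : k = 0
            · subst hk0; simp
            · have : 0 ≠ k := by omega
              simp [this, hk0]
          · have e := beta_smul_lanczosVec_add_two (A := A) (g := g) i
            rw [eq_sub_iff_add_eq, eq_sub_iff_add_eq] at e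
            rw [← e, inner_add_left, inner_add_left, real_inner_smul_left, real_inner_smul_left,
              real_inner_smul_left, ih (i + 2) (by omega) _ le_rfl, ih (i + 1) (by omega) _ le_rfl,
              ih i (by omega) _ le_rfl]
            by_cases hk0 : k = i + 1
            · subst hk0; simp [show i ≠ i + 1 + 1 by omega]
            · simp [show i + 1 ≠ k by omega, show i ≠ k by omega, show i ≠ k + 1 by omega]
    intro i hi j hj
    rcases Nat.lt_or_ge k i with h | h <;> rcases Nat.lt_or_ge k j with h' | h'
    · obtain rfl : i = k + 1 := by omega
      obtain rfl : j = k + 1 := by omega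
      rw [real_inner_self_eq_norm_sq, norm_lanczosVec_succ hk]; simp
    · obtain rfl : i = k + 1 := by omega
      rw [real_inner_comm, key j h', if_neg (by omega)]
    · obtain rfl : j = k + 1 := by omega
      rw [key i h, if_neg (by omega)]
    · exact ih i h j h'

theorem lanczosBeta_succ_ne_zero_of_lt_breakdown {j : ℕ} (hj : j < breakdown A g) :
    lanczosBeta A g (j + 1) ≠ 0 := Nat.notMem_of_lt_sInf hj

theorem orthonormal_lanczosVec (hA : (Matrix.toEuclideanLin A).IsSymmetric) (hg : g ≠ 0) {k : ℕ}
    (hk : k ≤ breakdown A g) : Orthonormal ℝ fun j : Fin (k + 1) => lanczosVec A g j := by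
  rw [orthonormal_iff_ite]
  intro i j
  rw [inner_lanczosVec hA hg k
    (fun l hl => lanczosBeta_succ_ne_zero_of_lt_breakdown (hl.trans_le hk)) i (by omega) j
    (by omega)]
  simp [Fin.ext_iff]

/-- Stationarity of the reduced problem says that the residual of `s = Q_k h` is orthogonal to the
Lanczos vectors, hence to `s` itself. -/
theorem inner_lift_residual (hA : (Matrix.toEuclideanLin A).IsSymmetric) (hg : g ≠ 0) {k : ℕ}
    (hk : k ≤ breakdown A g) {Δ lam : ℝ} {h : EuclideanSpace ℝ (Fin (k + 1))}
    (hh : IsMultiplier (projMatrix A g k) (EuclideanSpace.single 0 ‖g‖) Δ h lam) :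
    (inner ℝ (lift A g k h)
      (Matrix.toEuclideanLin A (lift A g k h) + lam • lift A g k h + g) : ℝ) = 0 := by
  have ho := orthonormal_lanczosVec hA hg hk
  suffices H : ∀ i : Fin (k + 1), (inner ℝ (lanczosVec A g i)
      (Matrix.toEuclideanLin A (lift A g k h) + lam • lift A g k h + g) : ℝ) = 0 by
    conv_lhs => arg 2; rw [lift]
    rw [sum_inner]
    exact Finset.sum_eq_zero fun i _ => by rw [real_inner_smul_left, H, mul_zero]
  intro i
  have h1 := congrArg (fun v => v i) hh.stationary
  simp only [PiLp.add_apply, PiLp.smul_apply, PiLp.neg_apply, smul_eq_mul,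
    Matrix.ofLp_toLpLin, Matrix.toLin'_apply, Matrix.mulVec, dotProduct, projMatrix,
    Matrix.of_apply] at h1
  have hT : (inner ℝ (lanczosVec A g i) (Matrix.toEuclideanLin A (lift A g k h)) : ℝ) =
      ∑ j : Fin (k + 1),
        inner ℝ (lanczosVec A g i) (Matrix.toEuclideanLin A (lanczosVec A g j)) * h j := by
    rw [lift, map_sum, inner_sum]
    exact Finset.sum_congr rfl fun j _ => by rw [map_smul, real_inner_smul_right, mul_comm]
  have hs : (inner ℝ (lanczosVec A g i) (lift A g k h) : ℝ) = h i := ho.inner_right_fintype h i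
  have hgq : (inner ℝ (lanczosVec A g i) g : ℝ) =
      (EuclideanSpace.single (0 : Fin (k + 1)) ‖g‖ : EuclideanSpace ℝ (Fin (k + 1))) i := by
    have e : g = ‖g‖ • lanczosVec A g ((0 : Fin (k + 1)) : ℕ) := (smul_inv_norm_smul g).symm
    conv_lhs => arg 3; rw [e]
    rw [real_inner_smul_right, orthonormal_iff_ite.1 ho i 0]
    simp
  rw [inner_add_right, inner_add_right, real_inner_smul_right, hT, hs, hgq, h1]
  ring

/-- The entry is the squared length of a column of the symmetric matrix `(T_k + lam I)⁻¹`; if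
`T_k + lam I` is singular, its junk inverse `0` is symmetric too. -/
theorem invSqEntry_nonneg (hA : (Matrix.toEuclideanLin A).IsSymmetric) (k : ℕ) (lam : ℝ) :
    0 ≤ invSqEntry A g k lam := by
  have h1 : (projMatrix A g k).IsSymm := by
    ext i j
    simp only [projMatrix, Matrix.transpose_apply, Matrix.of_apply]
    rw [← hA, real_inner_comm]
  have h2 : ((projMatrix A g k + lam • (1 : Matrix (Fin (k + 1)) (Fin (k + 1)) ℝ))⁻¹).IsSymm := by
    rw [Matrix.IsSymm, Matrix.transpose_nonsing_inv, Matrix.transpose_add, h1.eq,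
      Matrix.transpose_smul, Matrix.transpose_one]
  rw [invSqEntry, pow_two, Matrix.mul_apply]
  refine Finset.sum_nonneg fun j _ => ?_
  rw [h2.apply]
  exact mul_self_nonneg _

end GLTR

/-! ### The trust-region sphere -/

section Sphere

variable {E : Type*} [NormedAddCommGroup E] [InnerProductSpace ℝ E]

/-- Second-order necessary condition on the sphere: if the quadratic form of `B` is nonnegative on
all chords from `s` to points of the sphere through `s`, it is nonnegative everywhere. Every
direction not orthogonal to `s` is the direction of such a chord; the others are limits. -/
theorem inner_map_self_nonneg_of_sphere {B : E →ₗ[ℝ] E} (hB : B.IsSymmetric) {s : E}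
    (hs : s ≠ 0) (h : ∀ x, ‖x‖ = ‖s‖ → 0 ≤ (inner ℝ (x - s) (B (x - s)) : ℝ)) (v : E) :
    0 ≤ (inner ℝ v (B v) : ℝ) := by
  have key : ∀ u : E, (inner ℝ u s : ℝ) ≠ 0 → 0 ≤ (inner ℝ u (B u) : ℝ) := by
    intro u hu
    have hu0 : (inner ℝ u u : ℝ) ≠ 0 := by
      rw [Ne, inner_self_eq_zero]; rintro rfl; simp at hu
    -- `s - c • u` is the reflection of `s` in the hyperplane orthogonal to `u`.
    set c : ℝ := 2 * inner ℝ u s / inner ℝ u u with hc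
    have hc0 : c ≠ 0 := by positivity
    have hx : ‖s - c • u‖ = ‖s‖ := by
      rw [← sq_eq_sq₀ (norm_nonneg _) (norm_nonneg _), norm_sub_sq_real, norm_smul, mul_pow,
        ← real_inner_self_eq_norm_sq u, real_inner_smul_right, real_inner_comm, Real.norm_eq_abs,
        sq_abs, hc]
      field_simp
      ring
    have := h _ hx
    rw [show s - c • u - s = (-c) • u by rw [neg_smul]; abel, map_smul, real_inner_smul_left,
      real_inner_smul_right, ← mul_assoc, neg_mul_neg] at this
    exact nonneg_of_mul_nonneg_right this (mul_self_pos.2 hc0)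
  by_cases hv : (inner ℝ v s : ℝ) = 0
  · have hlim : Filter.Tendsto (fun ε : ℝ => (inner ℝ (v + ε • s) (B (v + ε • s)) : ℝ))
        (nhdsWithin 0 {0}ᶜ) (nhds (inner ℝ v (B v))) := by
      have hc : Continuous fun ε : ℝ => (inner ℝ v (B v) : ℝ) + 2 * ε * inner ℝ v (B s)
          + ε ^ 2 * inner ℝ s (B s) := by fun_prop
      have := (hc.tendsto 0).mono_left (nhdsWithin_le_nhds (s := {0}ᶜ))
      simp only [mul_zero, zero_mul, add_zero, ne_eq, OfNat.ofNat_ne_zero, not_false_eq_true,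
        zero_pow] at this
      refine this.congr fun ε => ?_
      have e : (inner ℝ s (B v) : ℝ) = inner ℝ v (B s) := by rw [← hB, real_inner_comm]
      simp only [map_add, map_smul, inner_add_left, inner_add_right, real_inner_smul_left,
        real_inner_smul_right, e]
      ring
    refine ge_of_tendsto hlim ?_
    filter_upwards [self_mem_nhdsWithin] with ε hε
    refine key _ ?_
    rw [inner_add_left, hv, real_inner_smul_left, zero_add]
    exact mul_ne_zero hε (by rwa [Ne, inner_self_eq_zero])
  · exact key v hv

/-- Rescaling an approximation `v` of `s` to the norm of `s` at most doubles the error. The vector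
`w` takes the place of the rescaled `v` when `v = 0`. -/
theorem exists_norm_eq_norm_sub_le {v s w : E} {K : Submodule ℝ E} (hv : v ∈ K) (hw : w ∈ K)
    (hws : ‖w‖ = ‖s‖) :
    ∃ u ∈ K, ‖u‖ = ‖s‖ ∧ ‖u - s‖ ≤ 2 * ‖v - s‖ := by
  by_cases h0 : v = 0
  · refine ⟨w, hw, hws, (norm_sub_le _ _).trans ?_⟩
    rw [h0, zero_sub, norm_neg, hws]
    linarith
  · have hn := norm_ne_zero_iff.2 h0
    refine ⟨(‖s‖ / ‖v‖) • v, K.smul_mem _ hv, ?_, ?_⟩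
    · rw [norm_smul, norm_div, norm_norm, norm_norm, div_mul_cancel₀ _ hn]
    · have h1 : ‖(‖s‖ / ‖v‖) • v - v‖ ≤ ‖v - s‖ := by
        have : (‖s‖ / ‖v‖) • v - v = ((‖s‖ - ‖v‖) / ‖v‖) • v := by
          rw [sub_div, div_self hn, sub_smul, one_smul]
        rw [this, norm_smul, norm_div, norm_norm, div_mul_cancel₀ _ hn, norm_sub_rev v s]
        exact abs_norm_sub_norm_le s v
      calc _ = ‖((‖s‖ / ‖v‖) • v - v) + (v - s)‖ := by rw [sub_add_sub_cancel]
        _ ≤ _ := norm_add_le _ _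
        _ ≤ _ := by linarith

end Sphere

/-! ### Krylov spaces and the objective -/

namespace GLTR

theorem toEuclideanLin_pow {ι : Type*} [Fintype ι] [DecidableEq ι] (A : Matrix ι ι ℝ) (j : ℕ) :
    Matrix.toEuclideanLin (A ^ j) = Matrix.toEuclideanLin A ^ j := by
  induction j with
  | zero => ext x; simp
  | succ j ih =>
    rw [pow_succ, pow_succ, ← ih]
    ext x
    simp [Matrix.toLpLin_apply, Module.End.mul_apply]

theorem aeval_mem_krylov {n : ℕ} (A : Matrix (Fin n) (Fin n) ℝ) (g : EuclideanSpace ℝ (Fin n))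
    {k : ℕ} {q : Polynomial ℝ} (hq : q.natDegree ≤ k) :
    Polynomial.aeval (Matrix.toEuclideanLin A) q g ∈ krylov A g k := by
  rw [Polynomial.aeval_eq_sum_range' (Nat.lt_succ_of_le hq), LinearMap.sum_apply]
  refine Submodule.sum_mem _ fun j hj => ?_
  rw [LinearMap.smul_apply, ← toEuclideanLin_pow]
  exact Submodule.smul_mem _ _ (Submodule.subset_span ⟨⟨j, Finset.mem_range.1 hj⟩, rfl⟩)

/-- On the sphere through a stationary point `s` the objective exceeds its value at `s` by half the
squared energy `⟨x - s, (A + lam I) (x - s)⟩`, because the term `lam / 2 * ‖x‖ ^ 2` is constant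
there. -/
theorem objective_sub_objective {ι : Type*} [Fintype ι] [DecidableEq ι] {A : Matrix ι ι ℝ}
    (hA : (Matrix.toEuclideanLin A).IsSymmetric) {g s x : EuclideanSpace ℝ ι} {lam : ℝ}
    (hs : Matrix.toEuclideanLin A s + lam • s = -g) (hx : ‖x‖ = ‖s‖) :
    objective A g x - objective A g s =
      (1 / 2) * inner ℝ (x - s) (Matrix.toEuclideanLin A (x - s) + lam • (x - s)) := by
  have hg : g = -(Matrix.toEuclideanLin A s + lam • s) := by rw [hs, neg_neg]
  have e1 : (inner ℝ (Matrix.toEuclideanLin A s) x : ℝ) =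
    inner ℝ x (Matrix.toEuclideanLin A s) := real_inner_comm _ _
  have e2 : (inner ℝ (Matrix.toEuclideanLin A s) s : ℝ) =
    inner ℝ s (Matrix.toEuclideanLin A s) := real_inner_comm _ _
  have e3 : (inner ℝ s (Matrix.toEuclideanLin A x) : ℝ) =
    inner ℝ x (Matrix.toEuclideanLin A s) := by rw [← hA, e1]
  have e4 : (inner ℝ x x : ℝ) = inner ℝ s s := by
    rw [real_inner_self_eq_norm_sq, real_inner_self_eq_norm_sq, hx]
  have e5 : (inner ℝ s x : ℝ) = inner ℝ x s := real_inner_comm _ _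
  simp only [objective, hg, map_sub, smul_sub, inner_add_left, inner_add_right, inner_sub_left,
    inner_sub_right, inner_neg_left, real_inner_smul_left, real_inner_smul_right, e1, e2, e3, e4,
    e5]
  ring

theorem toEuclideanLin_eigenvectorBasis {ι : Type*} [Fintype ι] [DecidableEq ι]
    {A : Matrix ι ι ℝ} (hA : A.IsHermitian) (i : ι) :
    Matrix.toEuclideanLin A (hA.eigenvectorBasis i) =
      hA.eigenvalues i • hA.eigenvectorBasis i :=
  (WithLp.ofLp_injective 2) (hA.mulVec_eigenvectorBasis i)

variable {n : ℕ} {A : Matrix (Fin n) (Fin n) ℝ} {g s : EuclideanSpace ℝ (Fin n)} {Δ lam αₙ : ℝ}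

/-- In the easy case `A + lam I` is positive definite: it is positive semidefinite by the
second-order condition, and if `lam = -αₙ` then `g = -(A - αₙ I) s` is orthogonal to the
eigenspace of `αₙ`, which is the hard case. -/
theorem IsTRSSolutionOn.add_multiplier_pos (hA : A.IsHermitian) (hΔ : 0 < Δ)
    (hαₙ : αₙ ∈ spectrum ℝ A) (hs : IsTRSSolutionOn A g Δ ⊤ s) (hlam : IsMultiplier A g Δ s lam)
    (heasy : ¬ IsHardCase A g αₙ lam) (hsn : ‖s‖ = Δ) : 0 < αₙ + lam := by
  have hT : (Matrix.toEuclideanLin A).IsSymmetric := Matrix.isSymmetric_toEuclideanLin_iff.2 hA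
  have hpsd := inner_map_self_nonneg_of_sphere (B := Matrix.toEuclideanLin A + lam • 1)
    (s := s) (hT.add (LinearMap.IsSymmetric.one.smul (by simp)))
    (by rw [← norm_ne_zero_iff, hsn]; exact hΔ.ne') fun x hx => by
      have h1 := objective_sub_objective hT hlam.stationary hx
      have h2 := hs.le x trivial (hx.trans hsn).le
      change (0 : ℝ) ≤ inner ℝ (x - s) (Matrix.toEuclideanLin A (x - s) + lam • (x - s))
      linarith
  have hne : αₙ + lam ≠ 0 := by
    intro h0
    refine heasy ⟨fun v hv => ?_, by linarith⟩
    rw [← neg_neg g, ← hlam.stationary, inner_neg_left, inner_add_left, hT, hv,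
      real_inner_smul_left, real_inner_smul_right, ← add_mul, h0, zero_mul, neg_zero]
  refine lt_of_le_of_ne ?_ hne.symm
  rw [hA.spectrum_real_eq_range_eigenvalues] at hαₙ
  obtain ⟨i, rfl⟩ := hαₙ
  have h := hpsd (hA.eigenvectorBasis i)
  have e : (Matrix.toEuclideanLin A + lam • 1) (hA.eigenvectorBasis i) =
      (hA.eigenvalues i + lam) • hA.eigenvectorBasis i := by
    rw [add_smul, ← toEuclideanLin_eigenvectorBasis]; rfl
  rw [e, real_inner_smul_right, real_inner_self_eq_norm_sq, hA.eigenvectorBasis.orthonormal.1 i]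
    at h
  simpa using h

end GLTR

theorem theorem5p5 {n : ℕ} (A : Matrix (Fin n) (Fin n) ℝ) (hA : A.IsSymm)
    (g : EuclideanSpace ℝ (Fin n)) (hg : g ≠ 0) (Δ : ℝ) (hΔ : 0 < Δ)
    (α₁ αₙ : ℝ) (hα₁ : IsGreatest (spectrum ℝ A) α₁) (hαₙ : IsLeast (spectrum ℝ A) αₙ)
    (sOpt : EuclideanSpace ℝ (Fin n)) (lamOpt : ℝ)
    (hsOpt : GLTR.IsTRSSolutionOn A g Δ ⊤ sOpt)
    (hlamOpt : GLTR.IsMultiplier A g Δ sOpt lamOpt)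
    (heasy : ¬ GLTR.IsHardCase A g αₙ lamOpt)
    (hsOptNorm : ‖sOpt‖ = Δ)
    (κ t : ℝ) (hκ : κ = (α₁ + lamOpt) / (αₙ + lamOpt))
    (ht : t = (Real.sqrt κ - 1) / (Real.sqrt κ + 1))
    (k : ℕ) (hk : k ≤ GLTR.breakdown A g)
    (sk : EuclideanSpace ℝ (Fin n)) (lamk : ℝ)
    (hsk : GLTR.IsGLTRIterate A g Δ k sk lamk) (hskNorm : ‖sk‖ = Δ) :
    ‖Matrix.toEuclideanLin A sk + lamk • sk + g‖ ≤
      (4 * GLTR.eta₁ A g Δ k lamOpt * Δ ^ 2 / ‖g‖ +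
          8 * (α₁ + lamOpt) * GLTR.eta₂ A g Δ k lamOpt * Δ ^ 3) * t ^ (2 * (k + 1)) +
        4 * Real.sqrt κ * Δ * (α₁ + lamOpt) * t ^ (k + 1) := by
  have hH : A.IsHermitian := by
    rw [Matrix.IsHermitian, Matrix.conjTranspose_eq_transpose_of_trivial, hA.eq]
  have hT : (Matrix.toEuclideanLin A).IsSymmetric := Matrix.isSymmetric_toEuclideanLin_iff.2 hH
  have ha := hsOpt.add_multiplier_pos hH hΔ hαₙ.1 hlamOpt heasy hsOptNorm
  have hab : αₙ + lamOpt ≤ α₁ + lamOpt := by linarith [hα₁.2 hαₙ.1]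
  set b := α₁ + lamOpt
  have hb : 0 < b := ha.trans_le hab
  have hκ1 : 1 ≤ √κ := by rwa [Real.one_le_sqrt, hκ, one_le_div ha]
  have ht0 : 0 ≤ t := by rw [ht]; exact div_nonneg (by linarith) (by linarith)
  set B : EuclideanSpace ℝ (Fin n) →ₗ[ℝ] EuclideanSpace ℝ (Fin n) :=
    Matrix.toEuclideanLin A + lamOpt • 1
  have hBapp : ∀ x, B x = Matrix.toEuclideanLin A x + lamOpt • x := fun x => rfl
  have hB : B.IsSymmetric := hT.add (LinearMap.IsSymmetric.one.smul (by simp))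
  have hBe : ∀ i, B (hH.eigenvectorBasis i) =
      (hH.eigenvalues i + lamOpt) • hH.eigenvectorBasis i := by
    intro i
    rw [hBapp, add_smul, GLTR.toEuclideanLin_eigenvectorBasis]
  have hμ : ∀ i, hH.eigenvalues i + lamOpt ∈ Set.Icc (αₙ + lamOpt) b := fun i =>
    ⟨by linarith [hαₙ.2 (hH.eigenvalues_mem_spectrum_real i)],
      add_le_add (hα₁.2 (hH.eigenvalues_mem_spectrum_real i)) le_rfl⟩
  -- A feasible competitor in the Krylov space, on the sphere and close to `sOpt`.
  obtain ⟨u, huK, hu, hus⟩ : ∃ u ∈ GLTR.krylov A g k,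
      ‖u‖ = ‖sOpt‖ ∧ ‖u - sOpt‖ ≤ 4 * t ^ (k + 1) * Δ := by
    obtain ⟨q, hq, hqs⟩ :=
      exists_poly_norm_aeval_map_sub_le hB hBe ha hab hμ (hκ ▸ ht) ht0 sOpt k
    have hv : Polynomial.aeval B q (B sOpt) ∈ GLTR.krylov A g k := by
      have h1 : B = Polynomial.aeval (Matrix.toEuclideanLin A)
          (Polynomial.X + Polynomial.C lamOpt) := by
        rw [map_add, Polynomial.aeval_X, Polynomial.aeval_C,
          Algebra.algebraMap_eq_smul_one]
      have h2 : B sOpt = -g := hlamOpt.stationary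
      rw [h2, map_neg, h1, ← Polynomial.aeval_comp]
      refine neg_mem (GLTR.aeval_mem_krylov A g ?_)
      rw [Polynomial.natDegree_comp, Polynomial.natDegree_X_add_C, mul_one]
      exact hq
    obtain ⟨u, huK, hu, hus⟩ :=
      exists_norm_eq_norm_sub_le hv hsk.1.mem (hskNorm.trans hsOptNorm.symm)
    refine ⟨u, huK, hu, hus.trans ?_⟩
    rw [hsOptNorm] at hqs
    linarith
  -- By optimality the energy of `sk - sOpt` is at most that of `u - sOpt`.
  have hen : inner ℝ (sk - sOpt) (B (sk - sOpt)) ≤ b * (4 * t ^ (k + 1) * Δ) ^ 2 := by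
    have h1 := GLTR.objective_sub_objective hT hlamOpt.stationary (hskNorm.trans hsOptNorm.symm)
    have h2 := GLTR.objective_sub_objective hT hlamOpt.stationary hu
    have h3 := hsk.1.le u huK (hu.trans hsOptNorm).le
    rw [← hBapp] at h1 h2
    calc _ ≤ inner ℝ (u - sOpt) (B (u - sOpt)) := by linarith
      _ ≤ b * ‖u - sOpt‖ ^ 2 := inner_map_self_le_of_eigenbasis hB hBe (fun i => (hμ i).2) _
      _ ≤ _ := by gcongr
  have hBn : ‖B (sk - sOpt)‖ ≤ 4 * Δ * b * t ^ (k + 1) := by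
    refine (abs_le_of_sq_le_sq' ?_ (by positivity)).2
    calc _ ≤ b * inner ℝ (sk - sOpt) (B (sk - sOpt)) :=
          norm_map_sq_le_of_eigenbasis hB hBe (fun i => ha.le.trans (hμ i).1) (fun i => (hμ i).2) _
      _ ≤ b * (b * (4 * t ^ (k + 1) * Δ) ^ 2) := by gcongr
      _ = _ := by ring
  set r := Matrix.toEuclideanLin A sk + lamk • sk + g with hr
  have hrs : (inner ℝ sk r : ℝ) = 0 := by
    obtain ⟨-, h, rfl, hh⟩ := hsk
    exact GLTR.inner_lift_residual hT hg hk hh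
  have hdec : B (sk - sOpt) = r + (lamOpt - lamk) • sk := by
    have h2 : B sOpt = -g := hlamOpt.stationary
    rw [map_sub, h2, hBapp, hr]
    module
  -- The two terms of `hdec` are orthogonal.
  have hrB : ‖r‖ ≤ ‖B (sk - sOpt)‖ := by
    refine (abs_le_of_sq_le_sq' ?_ (norm_nonneg _)).2
    have : (inner ℝ r ((lamOpt - lamk) • sk) : ℝ) = 0 := by
      rw [real_inner_smul_right, real_inner_comm, hrs, mul_zero]
    rw [hdec, norm_add_sq_real r, this]
    nlinarith [sq_nonneg ‖(lamOpt - lamk) • sk‖]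
  -- Everything else on the right-hand side is nonnegative, and `√κ ≥ 1`.
  have hD : 0 ≤ Δ ^ 2 + ‖g‖ ^ 2 * GLTR.invSqEntry A g k lamOpt := by
    have := GLTR.invSqEntry_nonneg (g := g) hT k lamOpt
    positivity
  have hη₁ : 0 ≤ GLTR.eta₁ A g Δ k lamOpt := div_nonneg (by positivity) hD
  have hη₂ : 0 ≤ GLTR.eta₂ A g Δ k lamOpt := div_nonneg (by norm_num) hD
  calc ‖r‖ ≤ 4 * Δ * b * t ^ (k + 1) := hrB.trans hBn
    _ = 0 + 4 * 1 * Δ * b * t ^ (k + 1) := by ring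
    _ ≤ _ := by
      gcongr
      positivity
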